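/- Let $g\ge 1$ be an integer and $q>1$ a real number. Let $c_0,\dots,c_g$ be real numbers with $c_0\neq 0$, and let $$P_g(x)=\sum_{k=0}^{g-1}c_k\,(x^{2g-k}+x^k)+c_g\,x^g ,$$ a self-reciprocal polynomial of degree $2g$. Write $T=\{z\in\mathbb C : |z|=1\}$, and $v[j]$ for the $j$-th component (counted from $1$) of a column vector $v$. For $k\ge 0$ and a number $m$ define the following matrices (rows and columns of the blocks are counted from $0$). * $V_k^+$ has $\lfloor (k+1)/2\rfloor+1$ rows and $k+1$ columns; its entry at $(i,j)$ is $1$ if $j=i$, or if $i\ge 1$ and $i+j=k+1$, and $0$ otherwise. * $V_k^-$ has $\lfloor k/2\rfloor+1$ rows and $k+1$ columns; its entry at $(i,j)$ is $1$ if $j=i$, is $-1$ if $i\ge 1$ and $i+j=k+1$, and $0$ otherwise. * $W_k^{\pm}$ is $V_k^{\pm}$ with the additional last column ${}^t(\pm1\ 0\ \cdots\ 0)$. * $\mathbf 0I_k$ is the $k\times(k+1)$ matrix consisting of a zero column followed by the identity matrix $I_k$. Put $$P_k(m)=\begin{bmatrix}V_k^+&0\\0&V_k^-\\ \mathbf 0I_k&-m\,\mathbf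 0I_k\end{bmatrix}\ \ \bigl((2k+2)\times(2k+2)\bigr),\qquad Q_k=\begin{bmatrix}W_k^+&0\\0&W_k^-\\0&0\end{bmatrix}\ \ \bigl((2k+2)\times(2k+4)\bigr).$$ The matrix $P_k(m)$ is invertible if $m\ne0$, and $P_0(m)$ is the identity for every $m$. For $\omega>0$ let $v_g(0)$ be the column vector of length $4g+2$ that consists of two copies, one below the other, of $${}^t\bigl(c_0q^{g\omega},\,c_1q^{(g-1)\omega},\dots,c_{g-1}q^{\omega},\,c_g,\,c_{g-1}q^{-\omega},\dots,c_1q^{-(g-1)\omega},\,c_0q^{-g\omega}\bigr),$$ and define successively, for $n=1,\dots,2g$, the numbers $m_{2g-n}=m_{2g-n}(\underline c;q^\omega)$ and the vectors $v_g(n)$ of length $4g-2n+2$ by $$m_{2g-n}=\frac{v_g(n-1)[1]+v_g(n-1)[2g-n+2]}{v_g(n-1)[2g-n+3]-v_g(n-1)[4g-2n+4]},\qquad v_g(n)=P_{2g-n}(m_{2g-n})^{-1}\,Q_{2g-n}\,v_g(n-1).$$ If a denominator vanishes, the corresponding $m_{2g-n}$ is infinite or undefined and does not count as satisfying the two inequalities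 below. Then all zeros of $P_g$ in $\mathbb C$ lie on $T$ (multiple zeros are allowed) if and only if $$m_{2g-n}(\underline c;q^\omega)>0\quad\text{and}\quad m_{2g-n}(\underline c;q^\omega)^{-1}>0$$ for every $1\le n\le 2g$ and every $\omega>0$. -/

import Mathlib

open Polynomial

namespace SelfReciprocal

noncomputable section

/-- The self-reciprocal polynomial
`P_g(x) = ∑_{k=0}^{g-1} c_k (x^(2g-k) + x^k) + c_g x^g` with real coefficients
`c = (c_0, …, c_g)`. It has degree `2g` exactly when `c_0 ≠ 0` (for `g ≥ 1`). -/
def selfReciprocalPoly (g : ℕ) (c : Fin (g + 1) → ℝ) : ℝ[X] :=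
  (∑ k : Fin g, C (c k.castSucc) * (X ^ (2 * g - (k : ℕ)) + X ^ (k : ℕ)))
    + C (c (Fin.last g)) * X ^ g

section LinearSystem

variable {K : Type*} [Field K]

/-- Entry in row `i`, column `j` (counted from `0`) of the block `V_k^+`, which has
`(k+1)/2 + 1` rows (integer division, i.e. `(k+3)/2` for odd `k` and `(k+2)/2` for even `k`)
and `k+1` columns: an identity matrix, together with a `1` at `(i, k+1-i)` for every
`i ≥ 1`. -/
def Vplus (K : Type*) [Field K] (k i j : ℕ) : K :=
  if j = i ∨ (i ≠ 0 ∧ i + j = k + 1) then 1 else 0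

/-- Entry in row `i`, column `j` (counted from `0`) of the block `V_k^-`, which has
`k/2 + 1` rows (integer division, i.e. `(k+1)/2` for odd `k` and `(k+2)/2` for even `k`)
and `k+1` columns: an identity matrix, together with a `-1` at `(i, k+1-i)` for every
`i ≥ 1`. -/
def Vminus (K : Type*) [Field K] (k i j : ℕ) : K :=
  if j = i then 1 else if i ≠ 0 ∧ i + j = k + 1 then -1 else 0

/-- Entry in row `i`, column `j` (counted from `0`) of the block `W_k^+`, which has the
rows of `V_k^+` and `k+2` columns: as `V_k^+`, with a `1` at `(0, k+1)` too. -/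
def Wplus (K : Type*) [Field K] (k i j : ℕ) : K :=
  if j = i ∨ i + j = k + 1 then 1 else 0

/-- Entry in row `i`, column `j` (counted from `0`) of the block `W_k^-`, which has the
rows of `V_k^-` and `k+2` columns: as `V_k^-`, with a `-1` at `(0, k+1)` too. -/
def Wminus (K : Type*) [Field K] (k i j : ℕ) : K :=
  if j = i then 1 else if i + j = k + 1 then -1 else 0

/-- The `(2k+2) × (2k+2)` matrix
`P_k(m) = [V_k^+, 0; 0, V_k^-; 𝟎I_k, -m 𝟎I_k]`, where `𝟎I_k` is the `k × (k+1)` matrix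
consisting of a zero column followed by the identity. The three block rows start at
the rows `0`, `(k+1)/2 + 1` and `k + 2`; the two block columns at the columns `0` and `k + 1`.
For `k = 0` it is the identity. -/
def matP (k : ℕ) (m : K) : Matrix (Fin (2 * k + 2)) (Fin (2 * k + 2)) K :=
  Matrix.of fun i j =>
    if (i : ℕ) < (k + 1) / 2 + 1 then
      if (j : ℕ) < k + 1 then Vplus K k i j else 0
    else if (i : ℕ) < k + 2 then
      if (j : ℕ) < k + 1 then 0 else Vminus K k (i - ((k + 1) / 2 + 1)) (j - (k + 1))
    else
      if (j : ℕ) < k + 1 then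
        if (j : ℕ) = (i - (k + 2)) + 1 then 1 else 0
      else
        if (j : ℕ) - (k + 1) = (i - (k + 2)) + 1 then -m else 0

/-- The `(2k+2) × (2k+4)` matrix `Q_k = [W_k^+, 0; 0, W_k^-; 0, 0]`. The three block rows start
at the rows `0`, `(k+1)/2 + 1` and `k + 2`; the two block columns at the columns `0` and
`k + 2`. -/
def matQ (K : Type*) [Field K] (k : ℕ) : Matrix (Fin (2 * k + 2)) (Fin (2 * k + 4)) K :=
  Matrix.of fun i j =>
    if (i : ℕ) < (k + 1) / 2 + 1 then
      if (j : ℕ) < k + 2 then Wplus K k i j else 0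
    else if (i : ℕ) < k + 2 then
      if (j : ℕ) < k + 2 then 0 else Wminus K k (i - ((k + 1) / 2 + 1)) (j - (k + 2))
    else 0

/-- For a column vector `w` of length `2k+4`, the quotient
`(w[1] + w[k+2]) / (w[k+3] - w[2k+4])`. Column vectors of finite length are represented by
functions on `ℕ` whose value at `j` is the `j`-th component, counted from `1`. -/
def ratio (k : ℕ) (w : ℕ → K) : K :=
  (w 1 + w (k + 2)) / (w (k + 3) - w (2 * k + 4))

/-- For a column vector `w` of length `2k+4`, the column vector `P_k(m)⁻¹ Q_k w` of length
`2k+2` (components counted from `1`, and `0` outside the range `1, …, 2k+2`). -/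
def step (k : ℕ) (m : K) (w : ℕ → K) : ℕ → K := fun j =>
  if h : 1 ≤ j ∧ j ≤ 2 * k + 2 then
    (((matP k m)⁻¹ * matQ K k).mulVec fun i => w ((i : ℕ) + 1)) ⟨j - 1, by omega⟩
  else 0

/-- The vectors `v_g(n)`, of length `4g-2n+2`, for `0 ≤ n ≤ 2g`, with initial vector
`v_g(0) = z` of length `4g+2`:
`v_g(n) = P_{2g-n}(m_{2g-n})⁻¹ Q_{2g-n} v_g(n-1)`. -/
def vec (g : ℕ) (z : ℕ → K) : ℕ → ℕ → K
  | 0 => z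
  | n + 1 =>
      step (2 * g - (n + 1)) (ratio (2 * g - (n + 1)) (vec g z n)) (vec g z n)

/-- The numbers `m_{2g-n}`, for `1 ≤ n ≤ 2g`, of the system with initial vector `z`:
`m_{2g-n} = (v[1] + v[2g-n+2]) / (v[2g-n+3] - v[4g-2n+4])` with `v = v_g(n-1)`. -/
def mValue (g : ℕ) (z : ℕ → K) (n : ℕ) : K :=
  ratio (2 * g - n) (vec g z (n - 1))

end LinearSystem

/-- The `j`-th component (`1 ≤ j ≤ 2g+1`) of the vector
`(c_0 q^(gω), c_1 q^((g-1)ω), …, c_{g-1} q^ω, c_g, c_{g-1} q^(-ω), …, c_0 q^(-gω))`. -/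
def halfVec (g : ℕ) (c : Fin (g + 1) → ℝ) (q ω : ℝ) (j : ℕ) : ℝ :=
  c ⟨min (j - 1) (2 * g - (j - 1)), by omega⟩ * q ^ (((g : ℝ) - ((j - 1 : ℕ) : ℝ)) * ω)

/-- The initial vector of length `4g+2`: two copies of `halfVec`, one below the other. -/
def initVec (g : ℕ) (c : Fin (g + 1) → ℝ) (q ω : ℝ) (j : ℕ) : ℝ :=
  if j ≤ 2 * g + 1 then halfVec g c q ω j else halfVec g c q ω (j - (2 * g + 1))

/-- The number `m_{2g-n}(c; q^ω)`, for `1 ≤ n ≤ 2g`. Since `x / 0 = 0` here, a quotient with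
zero denominator (an infinite or undefined `m_{2g-n}`) is not positive. If an `m_{2g-n}` is zero or
infinite, positivity for all `n` has failed whatever the later values are. -/
def mNumber (g : ℕ) (c : Fin (g + 1) → ℝ) (q ω : ℝ) (n : ℕ) : ℝ :=
  mValue g (initVec g c q ω) n

end

end SelfReciprocal

namespace SelfReciprocal

noncomputable section

/-! ### The linear system solved explicitly -/

/-! The recursion is the Schur–Cohn algorithm in disguise. Each `v_g(n)` has the form `(M·B, B)` for
a polynomial `B` (`Represents`). At the start `M = 1` and `B(x) = s^g P_g(x/s)` with `s = q^ω > 1`.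
With `r = M/m`, one step multiplies the part of `B` that is symmetric under `B ↦ B*` by `r` and
keeps the antisymmetric part. The value of `m` is exactly the one that kills the top coefficient
(`Represents.step`).

If all zeros of `P_g` lie on `T`, those of `B` have modulus `s`, so `B` has no zero in the closed
disc. Then `|B_N| < |B_0|`, which gives `m > 0`, and `|B*| ≤ |B|` on the disc, so the transform has
no zero there either (`schurTransform_ne_zero`).

Conversely, `|B|² - |B*|²` is multiplied by `r` at each step. Working back from the final nonzero
constant, positivity of all `m` excludes zeros of `B` in the open disc (`no_zeros_of_mValue_pos`).
So `P_g` has no zero in `|z| < 1/s`. Letting `s` tend to `1` clears the open unit disc, and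
self-reciprocity clears its exterior. -/

theorem sum_fin_two_blocks (n m : ℕ) (h : n = m + m) (f : ℕ → ℝ) :
    ∑ j : Fin n, f j = ∑ j ∈ Finset.range m, f j + ∑ j ∈ Finset.range m, f (m + j) := by
  rw [Fin.sum_univ_eq_sum_range, h, Finset.sum_range_add]

/-- In the middle row `2 * i = k + 1` the diagonal and the antidiagonal entries coincide and count
once. For the minus blocks `i ≤ k / 2` rules this row out. -/
theorem sum_Vplus (k i : ℕ) (hi : i ≤ (k + 1) / 2) (a : ℕ → ℝ) :
    ∑ j ∈ Finset.range (k + 1), Vplus ℝ k i j * a j =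
      a i + if i = 0 ∨ 2 * i = k + 1 then 0 else a (k + 1 - i) := by
  have h : ∀ j ∈ Finset.range (k + 1), Vplus ℝ k i j * a j =
      (if i = j then a j else 0) +
      (if k + 1 - i = j then (if i = 0 ∨ 2 * i = k + 1 then 0 else a j) else 0) := by
    intro j hj
    have := Finset.mem_range.1 hj
    unfold Vplus
    split_ifs <;> first | omega | simp
  rw [Finset.sum_congr rfl h, Finset.sum_add_distrib, Finset.sum_ite_eq, Finset.sum_ite_eq]
  simp only [Finset.mem_range]
  split_ifs <;> first | omega | simp

theorem sum_Wplus (k i : ℕ) (hi : i ≤ (k + 1) / 2) (a : ℕ → ℝ) :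
    ∑ j ∈ Finset.range (k + 2), Wplus ℝ k i j * a j =
      a i + if 2 * i = k + 1 then 0 else a (k + 1 - i) := by
  have h : ∀ j ∈ Finset.range (k + 2), Wplus ℝ k i j * a j =
      (if i = j then a j else 0) +
      (if k + 1 - i = j then (if 2 * i = k + 1 then 0 else a j) else 0) := by
    intro j hj
    have := Finset.mem_range.1 hj
    unfold Wplus
    split_ifs <;> first | omega | simp
  rw [Finset.sum_congr rfl h, Finset.sum_add_distrib, Finset.sum_ite_eq, Finset.sum_ite_eq]
  simp only [Finset.mem_range]
  split_ifs <;> first | omega | simp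

theorem sum_Vminus (k i : ℕ) (hi : i ≤ k / 2) (a : ℕ → ℝ) :
    ∑ j ∈ Finset.range (k + 1), Vminus ℝ k i j * a j =
      a i - if i = 0 then 0 else a (k + 1 - i) := by
  have h : ∀ j ∈ Finset.range (k + 1), Vminus ℝ k i j * a j =
      (if i = j then a j else 0) -
      (if k + 1 - i = j then (if i = 0 then 0 else a j) else 0) := by
    intro j hj
    have := Finset.mem_range.1 hj
    unfold Vminus
    split_ifs <;> first | omega | simp
  rw [Finset.sum_congr rfl h, Finset.sum_sub_distrib, Finset.sum_ite_eq, Finset.sum_ite_eq]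
  simp only [Finset.mem_range]
  split_ifs <;> first | omega | simp

theorem sum_Wminus (k i : ℕ) (hi : i ≤ k / 2) (a : ℕ → ℝ) :
    ∑ j ∈ Finset.range (k + 2), Wminus ℝ k i j * a j = a i - a (k + 1 - i) := by
  have h : ∀ j ∈ Finset.range (k + 2), Wminus ℝ k i j * a j =
      (if i = j then a j else 0) - (if k + 1 - i = j then a j else 0) := by
    intro j hj
    have := Finset.mem_range.1 hj
    unfold Wminus
    split_ifs <;> first | omega | simp
  rw [Finset.sum_congr rfl h, Finset.sum_sub_distrib, Finset.sum_ite_eq, Finset.sum_ite_eq]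
  simp only [Finset.mem_range]
  split_ifs <;> first | omega | simp

theorem matP_mulVec (k : ℕ) (m : ℝ) (u : ℕ → ℝ) (i : Fin (2 * k + 2)) :
    (matP k m).mulVec (fun j => u j) i =
      if (i : ℕ) < (k + 1) / 2 + 1 then
        u i + if (i : ℕ) = 0 ∨ 2 * (i : ℕ) = k + 1 then 0 else u (k + 1 - i)
      else if (i : ℕ) < k + 2 then
        u (k + 1 + (i - ((k + 1) / 2 + 1))) -
          if (i : ℕ) - ((k + 1) / 2 + 1) = 0 then 0
          else u (k + 1 + (k + 1 - (i - ((k + 1) / 2 + 1))))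
      else u (i - (k + 2) + 1) - m * u (k + 1 + (i - (k + 2) + 1)) := by
  have hi := i.2
  simp only [Matrix.mulVec, dotProduct, matP, Matrix.of_apply]
  rw [sum_fin_two_blocks (2 * k + 2) (k + 1) (by ring) fun j =>
    (if (i : ℕ) < (k + 1) / 2 + 1 then
      if j < k + 1 then Vplus ℝ k i j else 0
    else if (i : ℕ) < k + 2 then
      if j < k + 1 then 0 else Vminus ℝ k (i - ((k + 1) / 2 + 1)) (j - (k + 1))
    else
      if j < k + 1 then
        if j = (i - (k + 2)) + 1 then 1 else 0
      else
        if j - (k + 1) = (i - (k + 2)) + 1 then -m else 0) * u j]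
  have hlt : ∀ j, ¬ (k + 1 + j < k + 1) := by intro j; omega
  simp only [hlt, if_false, Nat.add_sub_cancel_left]
  rw [Finset.sum_congr rfl (g := fun j => (if (i : ℕ) < (k + 1) / 2 + 1 then
      Vplus ℝ k i j else if (i : ℕ) < k + 2 then 0 else
        if j = (i - (k + 2)) + 1 then 1 else 0) * u j)
      (fun j hj => by simp only [Finset.mem_range.1 hj, if_true])]
  split_ifs <;> first
    | (simp only [zero_mul, Finset.sum_const_zero, add_zero, zero_add]
       first
        | rw [sum_Vplus k i (by omega)]; simp_all
        | rw [sum_Vminus k _ (by omega) fun j => u (k + 1 + j)]; simp_all)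
    | (have : (i : ℕ) - (k + 2) + 1 < k + 1 := by omega
       simp [ite_mul, Finset.sum_ite_eq', this]; try ring)

theorem matQ_mulVec (k : ℕ) (u : ℕ → ℝ) (i : Fin (2 * k + 2)) :
    (matQ ℝ k).mulVec (fun j => u j) i =
      if (i : ℕ) < (k + 1) / 2 + 1 then
        u i + if 2 * (i : ℕ) = k + 1 then 0 else u (k + 1 - i)
      else if (i : ℕ) < k + 2 then
        u (k + 2 + (i - ((k + 1) / 2 + 1))) - u (k + 2 + (k + 1 - (i - ((k + 1) / 2 + 1))))
      else 0 := by
  have hi := i.2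
  simp only [Matrix.mulVec, dotProduct, matQ, Matrix.of_apply]
  rw [sum_fin_two_blocks (2 * k + 4) (k + 2) (by ring) fun j =>
    (if (i : ℕ) < (k + 1) / 2 + 1 then
      if j < k + 2 then Wplus ℝ k i j else 0
    else if (i : ℕ) < k + 2 then
      if j < k + 2 then 0 else Wminus ℝ k (i - ((k + 1) / 2 + 1)) (j - (k + 2))
    else 0) * u j]
  have hlt : ∀ j, ¬ (k + 2 + j < k + 2) := by intro j; omega
  simp only [hlt, if_false, Nat.add_sub_cancel_left]
  rw [Finset.sum_congr rfl (g := fun j => (if (i : ℕ) < (k + 1) / 2 + 1 then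
      Wplus ℝ k i j else if (i : ℕ) < k + 2 then 0 else 0) * u j)
      (fun j hj => by simp only [Finset.mem_range.1 hj, if_true])]
  split_ifs <;>
    (simp only [zero_mul, Finset.sum_const_zero, add_zero, zero_add]
     try first
        | rw [sum_Wplus k i (by omega)]; simp_all
        | rw [sum_Wminus k _ (by omega) fun j => u (k + 2 + j)])

/-- For a kernel vector `(a, b)` the last rows give `a_j = m b_j`. The other rows then say that `m
(b_j + b_{k+1-j})` and `b_j - b_{k+1-j}` vanish, and that `a_0 = b_0 = 0`. -/
theorem isUnit_matP (k : ℕ) {m : ℝ} (hm : m ≠ 0) : IsUnit (matP k m) := by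
  rw [← Matrix.mulVec_injective_iff_isUnit]
  refine (injective_iff_map_eq_zero (matP k m).mulVecLin).2 fun x hx => ?_
  set u : ℕ → ℝ := fun j => if h : j < 2 * k + 2 then x ⟨j, h⟩ else 0 with hu
  have hxu : x = fun j : Fin (2 * k + 2) => u j := by
    ext j
    simp [hu]
  have hrow : ∀ i (hi : i < 2 * k + 2), (matP k m).mulVec (fun j => u j) ⟨i, hi⟩ = 0 := by
    intro i hi
    rw [← hxu]
    exact congrFun hx ⟨i, hi⟩
  simp only [matP_mulVec] at hrow
  have ha : ∀ j, 1 ≤ j → j ≤ k → u j = m * u (k + 1 + j) := by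
    intro j h1 h2
    have h := hrow (k + 2 + (j - 1)) (by omega)
    rw [if_neg (by omega), if_neg (by omega), show k + 2 + (j - 1) - (k + 2) + 1 = j by omega] at h
    linarith
  have ha0 : u 0 = 0 := by simpa using hrow 0 (by omega)
  have hb0 : u (k + 1) = 0 := by
    have h := hrow ((k + 1) / 2 + 1) (by omega)
    rw [if_neg (by omega), if_pos (by omega)] at h
    simpa using h
  have hlow : ∀ j, 1 ≤ j → 2 * j ≤ k → u (k + 1 + j) = 0 ∧ u (k + 1 + (k + 1 - j)) = 0 := by
    intro j h1 h2
    have e1 := hrow j (by omega)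
    rw [if_pos (by omega), if_neg (by omega), ha j h1 (by omega),
      ha (k + 1 - j) (by omega) (by omega), ← mul_add] at e1
    have e2 := hrow ((k + 1) / 2 + 1 + j) (by omega)
    rw [if_neg (by omega), if_pos (by omega), Nat.add_sub_cancel_left, if_neg (by omega)] at e2
    have e3 := (mul_eq_zero.1 e1).resolve_left hm
    constructor <;> linarith
  have hmid : ∀ j, 2 * j = k + 1 → 1 ≤ k → u (k + 1 + j) = 0 := by
    intro j h1 h2
    have e1 := hrow j (by omega)
    rw [if_pos (by omega), if_pos (by omega), add_zero, ha j (by omega) (by omega)] at e1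
    exact (mul_eq_zero.1 e1).resolve_left hm
  have hb : ∀ j, j ≤ k → u (k + 1 + j) = 0 := by
    intro j hj
    rcases Nat.eq_zero_or_pos j with rfl | h1
    · simpa using hb0
    rcases lt_trichotomy (2 * j) (k + 1) with h | h | h
    · exact (hlow j h1 (by omega)).1
    · exact hmid j h (by omega)
    · have := (hlow (k + 1 - j) (by omega) (by omega)).2
      rwa [show k + 1 - (k + 1 - j) = j by omega] at this
  ext j
  rw [hxu]
  change u j = 0
  by_cases h : (j : ℕ) ≤ k
  · rcases Nat.eq_zero_or_pos (j : ℕ) with h0 | h0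
    · rw [h0, ha0]
    · rw [ha j h0 h, hb j h, mul_zero]
  · have := hb (j - (k + 1)) (by omega)
    rwa [show k + 1 + ((j : ℕ) - (k + 1)) = j by omega] at this

/-- The vector `w` consists of the coefficients, up to the degree `k`, of `M • B` and of `B`. -/
structure Represents (k : ℕ) (M : ℝ) (B : ℝ[X]) (w : ℕ → ℝ) : Prop where
  natDegree_le : B.natDegree ≤ k
  fst : ∀ j ≤ k, w (j + 1) = M * B.coeff j
  snd : ∀ j ≤ k, w (k + 1 + j + 1) = B.coeff j

/-- The Schur transform `((r+1) B + (r-1) B*) / 2`, where `B*` is the reciprocal polynomial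
with respect to the degree `N`. -/
def schurTransform (N : ℕ) (r : ℝ) (B : ℝ[X]) : ℝ[X] :=
  C ((r + 1) / 2) * B + C ((r - 1) / 2) * reflect N B

theorem coeff_schurTransform {N j : ℕ} (hj : j ≤ N) (r : ℝ) (B : ℝ[X]) :
    (schurTransform N r B).coeff j = (r + 1) / 2 * B.coeff j + (r - 1) / 2 * B.coeff (N - j) := by
  simp [schurTransform, coeff_reflect, revAt_le hj]

theorem natDegree_schurTransform_le {k : ℕ} {r : ℝ} {B : ℝ[X]} (hB : B.natDegree ≤ k + 1)
    (hr : (r + 1) * B.coeff (k + 1) + (r - 1) * B.coeff 0 = 0) :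
    (schurTransform (k + 1) r B).natDegree ≤ k := by
  rw [natDegree_le_iff_coeff_eq_zero]
  intro j hj
  rcases Nat.lt_or_ge (k + 1) j with h | h
  · have h1 : B.coeff j = 0 := coeff_eq_zero_of_natDegree_lt (by omega)
    simp [schurTransform, coeff_reflect, revAt_eq_self_of_lt h, h1]
  · obtain rfl : j = k + 1 := by omega
    rw [coeff_schurTransform le_rfl, Nat.sub_self]
    linarith

theorem Represents.ratio_eq {k : ℕ} {M : ℝ} {B : ℝ[X]} {w : ℕ → ℝ}
    (h : Represents (k + 1) M B w) :
    ratio k w = M * (B.coeff 0 + B.coeff (k + 1)) / (B.coeff 0 - B.coeff (k + 1)) := by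
  have h1 := h.fst 0 (by omega)
  have h2 := h.fst (k + 1) le_rfl
  have h3 := h.snd 0 (by omega)
  have h4 := h.snd (k + 1) le_rfl
  rw [zero_add] at h1
  rw [ratio, h1, show k + 2 = k + 1 + 1 by ring, h2, show k + 3 = k + 1 + 1 + 0 + 1 by ring, h3,
    show 2 * k + 4 = k + 1 + 1 + (k + 1) + 1 by ring, h4, mul_add]

/-- With `r = M / m` this is the condition that cancels the top coefficient of the Schur transform.
A zero denominator would make `ratio` equal to `0`, so `hm` excludes that case too. -/
theorem Represents.ratio_relation {k : ℕ} {M : ℝ} {B : ℝ[X]} {w : ℕ → ℝ}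
    (h : Represents (k + 1) M B w) (hm : ratio k w ≠ 0) :
    M / ratio k w * (B.coeff 0 + B.coeff (k + 1)) = B.coeff 0 - B.coeff (k + 1) := by
  have e := h.ratio_eq
  have hd : B.coeff 0 - B.coeff (k + 1) ≠ 0 := by
    intro h0
    rw [h0, div_zero] at e
    exact hm e
  have e2 : ratio k w * (B.coeff 0 - B.coeff (k + 1)) = M * (B.coeff 0 + B.coeff (k + 1)) := by
    rw [e, div_mul_cancel₀ _ hd]
  rw [div_mul_eq_mul_div, ← e2, mul_div_cancel_left₀ _ hm]

/-- The coefficient vector `(m B', B')` solves `P u = Q w`: the rows of `V⁺` and `V⁻` compare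
symmetric and antisymmetric parts, and the last rows say that the first half is `m` times the
second. Invertibility of `P` makes this the only solution. -/
theorem Represents.step {k : ℕ} {M : ℝ} {B : ℝ[X]} {w : ℕ → ℝ}
    (h : Represents (k + 1) M B w) (hm : ratio k w ≠ 0) :
    Represents k (ratio k w) (schurTransform (k + 1) (M / ratio k w) B)
      (step k (ratio k w) w) := by
  have hr := h.ratio_relation hm
  set m := ratio k w with hm_def
  set r := M / m with hr_def
  have hrm : M = m * r := by rw [hr_def, mul_div_cancel₀ _ hm]
  set B' := schurTransform (k + 1) r B with hB'
  set u : ℕ → ℝ := fun j => if j ≤ k then m * B'.coeff j else B'.coeff (j - (k + 1)) with hu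
  have hu1 : ∀ j, j ≤ k → u j = m * B'.coeff j := fun j hj => if_pos hj
  have hu2 : ∀ j, u (k + 1 + j) = B'.coeff j := fun j => by
    simp [hu, show ¬ (k + 1 + j ≤ k) by omega]
  have hw1 : ∀ j, j ≤ k + 1 → w (j + 1) = M * B.coeff j := h.fst
  have hw2 : ∀ j, j ≤ k + 1 → w (k + 2 + j + 1) = B.coeff j := h.snd
  have hPQ : (matP k m).mulVec (fun j => u j) = (matQ ℝ k).mulVec (fun j => w ((j : ℕ) + 1)) := by
    ext i
    have hi := i.2
    rw [matP_mulVec, matQ_mulVec k fun j => w (j + 1)]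
    by_cases h1 : (i : ℕ) < (k + 1) / 2 + 1
    · rw [if_pos h1, if_pos h1, hu1 _ (by omega), hw1 _ (by omega), hB',
        coeff_schurTransform (by omega), hrm]
      by_cases h2 : (i : ℕ) = 0
      · rw [if_pos (Or.inl h2), if_neg (by omega), h2, Nat.sub_zero, hw1 _ le_rfl, hrm]
        -- Row `0` of `V⁺` lacks the entry for degree `k + 1`, which is harmless because that
        -- coefficient of `B'` vanishes.
        linear_combination m / 2 * (-hr)
      by_cases h3 : 2 * (i : ℕ) = k + 1
      · rw [if_pos (Or.inr h3), if_pos h3, show k + 1 - (i : ℕ) = i by omega]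
        ring
      · rw [if_neg (by omega), if_neg h3, hu1 _ (by omega), hw1 _ (by omega), hB',
          coeff_schurTransform (by omega), show k + 1 - (k + 1 - (i : ℕ)) = i by omega, hrm]
        ring
    by_cases h2 : (i : ℕ) < k + 2
    · rw [if_neg h1, if_pos h2, if_neg h1, if_pos h2]
      generalize hl : (i : ℕ) - ((k + 1) / 2 + 1) = l
      rw [hu2, hw2 _ (by omega), hw2 _ (by omega), hB', coeff_schurTransform (by omega)]
      by_cases h3 : l = 0
      · rw [if_pos h3, h3, Nat.sub_zero]
        linear_combination (1 / 2) * hr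
      · rw [if_neg h3, hu2, hB', coeff_schurTransform (by omega),
          show k + 1 - (k + 1 - l) = l by omega]
        ring
    · rw [if_neg h1, if_neg h2, if_neg h1, if_neg h2, hu1 _ (by omega), hu2, sub_self]
  have hsol : ((matP k m)⁻¹ * matQ ℝ k).mulVec (fun j => w ((j : ℕ) + 1)) =
      fun j : Fin (2 * k + 2) => u j := by
    rw [← Matrix.mulVec_mulVec, ← hPQ, Matrix.mulVec_mulVec,
      Matrix.nonsing_inv_mul _ ((Matrix.isUnit_iff_isUnit_det _).1 (isUnit_matP k hm)),
      Matrix.one_mulVec]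
  have hstep : ∀ j, j < 2 * k + 2 → SelfReciprocal.step k m w (j + 1) = u j := by
    intro j hj
    rw [SelfReciprocal.step, dif_pos (by omega), hsol]
    rfl
  refine ⟨natDegree_schurTransform_le h.natDegree_le (by linear_combination hr), ?_, ?_⟩
  · intro j hj
    rw [hstep j (by omega), hu1 j hj]
  · intro j hj
    rw [hstep _ (by omega), hu2]

/-! ### The Schur–Cohn recursion -/

theorem aeval_reflect {N : ℕ} {B : ℝ[X]} (hB : B.natDegree ≤ N) {z : ℂ} (hz : z ≠ 0) :
    aeval z (reflect N B) = z ^ N * aeval z⁻¹ B := by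
  have := invertibleOfNonzero (inv_ne_zero hz)
  have h := eval₂_reflect_mul_pow (algebraMap ℝ ℂ) z⁻¹ N B hB
  rw [invOf_eq_inv, inv_inv, ← aeval_def, ← aeval_def] at h
  rw [← h, inv_pow, mul_comm, mul_assoc, inv_mul_cancel₀ (pow_ne_zero _ hz), mul_one]

theorem reflect_succ {N : ℕ} {B : ℝ[X]} (hB : B.natDegree ≤ N) :
    reflect (N + 1) B = reflect N B * X := by
  have h := reflect_mul B (1 : ℝ[X]) hB (G := 1) (by simp)
  rw [mul_one] at h
  rw [h]
  simp

theorem reflect_schurTransform (N : ℕ) (r : ℝ) (B : ℝ[X]) :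
    reflect N (schurTransform N r B) =
      C ((r + 1) / 2) * reflect N B + C ((r - 1) / 2) * B := by
  simp [schurTransform, reflect_add, reflect_C_mul]

/-- The two coefficients are real, so the cross terms cancel, and the difference of their squares is
`r`. -/
theorem norm_sq_sub_norm_sq (r : ℝ) (a b : ℂ) :
    ‖((r + 1) / 2 : ℂ) * a + ((r - 1) / 2 : ℂ) * b‖ ^ 2 -
      ‖((r + 1) / 2 : ℂ) * b + ((r - 1) / 2 : ℂ) * a‖ ^ 2 = r * (‖a‖ ^ 2 - ‖b‖ ^ 2) := by
  rw [show ((r + 1) / 2 : ℂ) = (((r + 1) / 2 : ℝ) : ℂ) by push_cast; rfl,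
    show ((r - 1) / 2 : ℂ) = (((r - 1) / 2 : ℝ) : ℂ) by push_cast; rfl]
  simp only [← Complex.normSq_eq_norm_sq, Complex.normSq_apply, Complex.add_re, Complex.add_im,
    Complex.re_ofReal_mul, Complex.im_ofReal_mul]
  ring

theorem aeval_schurTransform_norm_sq (N : ℕ) (r : ℝ) (B : ℝ[X]) (z : ℂ) :
    ‖aeval z (schurTransform N r B)‖ ^ 2 - ‖aeval z (reflect N (schurTransform N r B))‖ ^ 2 =
      r * (‖aeval z B‖ ^ 2 - ‖aeval z (reflect N B)‖ ^ 2) := by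
  rw [reflect_schurTransform, schurTransform, ← norm_sq_sub_norm_sq]
  simp [aeval_C]

/-- This is the Blaschke factor estimate: the difference of the squares factors as `(‖a‖² - 1)(1 -
‖z‖²)`. -/
theorem norm_one_sub_mul_le {a z : ℂ} (ha : 1 < ‖a‖) (hz : ‖z‖ ≤ 1) :
    ‖1 - a * z‖ ≤ ‖starRingEnd ℂ z - a‖ := by
  refine (sq_le_sq₀ (norm_nonneg _) (norm_nonneg _)).1 ?_
  have h : ‖starRingEnd ℂ z - a‖ ^ 2 - ‖1 - a * z‖ ^ 2 = (‖a‖ ^ 2 - 1) * (1 - ‖z‖ ^ 2) := by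
    simp only [← Complex.normSq_eq_norm_sq, Complex.normSq_apply, Complex.sub_re, Complex.sub_im,
      Complex.mul_re, Complex.mul_im, Complex.conj_re, Complex.conj_im, Complex.one_re,
      Complex.one_im]
    ring
  have h1 : 0 ≤ (‖a‖ ^ 2 - 1) * (1 - ‖z‖ ^ 2) :=
    mul_nonneg (by nlinarith [norm_nonneg a]) (by nlinarith [norm_nonneg z])
  linarith

theorem norm_multiset_prod (s : Multiset ℂ) : ‖s.prod‖ = (s.map norm).prod :=
  map_multiset_prod (normHom : ℂ →*₀ ℝ) s

theorem aeval_eq_leadingCoeff_mul_prod (B : ℝ[X]) (z : ℂ) :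
    aeval z B = (B.leadingCoeff : ℂ) * ((B.aroots ℂ).map fun a => z - a).prod := by
  have h := (IsAlgClosed.splits (B.map (algebraMap ℝ ℂ))).eval_eq_prod_roots z
  rw [eval_map_algebraMap, leadingCoeff_map] at h
  exact h

theorem card_aroots (B : ℝ[X]) : (B.aroots ℂ).card = B.natDegree := by
  have h := (IsAlgClosed.splits (B.map (algebraMap ℝ ℂ))).natDegree_eq_card_roots
  rw [natDegree_map] at h
  exact h.symm

/-- In degree exactly `N`, the quotient `|B_0| / |B_N|` is the product of the moduli of the roots,
all larger than `1`; `hN` ensures that there is a root. In smaller degree `B_N = 0`. -/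
theorem norm_coeff_lt_of_no_zeros {N : ℕ} (hN : 1 ≤ N) {B : ℝ[X]} (hB : B.natDegree ≤ N)
    (h0 : ∀ z : ℂ, ‖z‖ ≤ 1 → aeval z B ≠ 0) : |B.coeff N| < |B.coeff 0| := by
  have hne : B.coeff 0 ≠ 0 := by
    intro h
    refine h0 0 (by simp) ?_
    rw [← coeff_zero_eq_aeval_zero', h, map_zero]
  have hB0 : B ≠ 0 := by
    rintro rfl
    simp at hne
  rcases hB.lt_or_eq with hlt | heq
  · rw [coeff_eq_zero_of_natDegree_lt hlt]
    simpa using hne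
  have he := aeval_eq_leadingCoeff_mul_prod B 0
  rw [← coeff_zero_eq_aeval_zero'] at he
  have he2 := congrArg norm he
  rw [norm_mul, norm_multiset_prod, Multiset.map_map] at he2
  simp only [Complex.coe_algebraMap, Complex.norm_real, Real.norm_eq_abs, zero_sub] at he2
  rw [he2, ← heq, coeff_natDegree]
  refine lt_mul_of_one_lt_right (abs_pos.2 (leadingCoeff_ne_zero.2 hB0)) ?_
  have hroot : ∀ a ∈ B.aroots ℂ, 1 < ‖a‖ := by
    intro a ha
    by_contra! hle
    exact h0 a hle ((mem_aroots.1 ha).2)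
  have hcard : (B.aroots ℂ) ≠ 0 := by
    rw [← Multiset.card_pos, card_aroots]
    omega
  have : ∀ s : Multiset ℂ, (∀ a ∈ s, 1 < ‖a‖) → s ≠ 0 →
      1 < (s.map norm).prod := by
    intro s
    induction s using Multiset.induction_on with
    | empty => simp
    | cons a s ih =>
      intro hs _
      have ha := hs a (Multiset.mem_cons_self a s)
      by_cases h : s = 0
      · simpa [h] using ha
      · have := ih (fun b hb => hs b (Multiset.mem_cons_of_mem hb)) h
        simp only [Multiset.map_cons, Multiset.prod_cons]
        exact one_lt_mul ha.le this
  simpa [Function.comp_def] using this _ hroot hcard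

theorem aeval_conj (B : ℝ[X]) (z : ℂ) :
    aeval (starRingEnd ℂ z) B = starRingEnd ℂ (aeval z B) :=
  aeval_algHom_apply Complex.conjAe.toAlgHom z B

/-- For `z ≠ 0`, `B*(z)` is a power of `z` times the leading coefficient times `∏ (1 - a z)` over
the roots `a`. Since `B` is real, `|B(z)| = |B(z̄)|`, so the factors `1 - a z` and `z̄ - a` can be
compared root by root. -/
theorem norm_reflect_le_of_no_zeros {N : ℕ} (hN : 1 ≤ N) {B : ℝ[X]} (hB : B.natDegree ≤ N)
    (h0 : ∀ z : ℂ, ‖z‖ ≤ 1 → aeval z B ≠ 0) {z : ℂ} (hz : ‖z‖ ≤ 1) :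
    ‖aeval z (reflect N B)‖ ≤ ‖aeval z B‖ := by
  by_cases hz0 : z = 0
  · subst hz0
    rw [← coeff_zero_eq_aeval_zero', ← coeff_zero_eq_aeval_zero', coeff_reflect,
      revAt_le (Nat.zero_le N), Nat.sub_zero]
    simpa using (norm_coeff_lt_of_no_zeros hN hB h0).le
  have hroot : ∀ a ∈ B.aroots ℂ, 1 < ‖a‖ := by
    intro a ha
    by_contra! hle
    exact h0 a hle ((mem_aroots.1 ha).2)
  obtain ⟨d, rfl⟩ := Nat.exists_eq_add_of_le hB
  have h1 : ‖aeval z B‖ = ‖aeval (starRingEnd ℂ z) B‖ := by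
    rw [aeval_conj, Complex.norm_conj]
  have hprod : ∀ s : Multiset ℂ,
      z ^ s.card * (s.map fun a => z⁻¹ - a).prod = (s.map fun a => 1 - a * z).prod := by
    intro s
    induction s using Multiset.induction_on with
    | empty => simp
    | cons a s ih =>
      simp only [Multiset.map_cons, Multiset.prod_cons, Multiset.card_cons, ← ih, pow_succ]
      field_simp
  have hle : ∀ s : Multiset ℂ, (∀ a ∈ s, 1 < ‖a‖) →
      ‖(s.map fun a => 1 - a * z).prod‖ ≤ ‖(s.map fun a => starRingEnd ℂ z - a).prod‖ := by
    intro s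
    induction s using Multiset.induction_on with
    | empty => simp
    | cons a s ih =>
      intro hs
      simp only [Multiset.map_cons, Multiset.prod_cons, norm_mul]
      exact mul_le_mul (norm_one_sub_mul_le (hs a (Multiset.mem_cons_self a s)) hz)
        (ih fun b hb => hs b (Multiset.mem_cons_of_mem hb)) (norm_nonneg _) (norm_nonneg _)
  rw [h1, aeval_reflect hB hz0, aeval_eq_leadingCoeff_mul_prod B z⁻¹,
    aeval_eq_leadingCoeff_mul_prod B (starRingEnd ℂ z)]
  have h2 : z ^ (B.natDegree + d) *
      ((B.leadingCoeff : ℂ) * ((B.aroots ℂ).map fun a => z⁻¹ - a).prod) =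
      z ^ d * ((B.leadingCoeff : ℂ) * ((B.aroots ℂ).map fun a => 1 - a * z).prod) := by
    rw [← hprod, card_aroots]
    ring
  rw [h2, norm_mul, norm_pow, norm_mul, norm_mul]
  calc _ ≤ 1 * (‖(B.leadingCoeff : ℂ)‖ * ‖((B.aroots ℂ).map fun a => 1 - a * z).prod‖) := by
        gcongr
        exact pow_le_one₀ (norm_nonneg _) hz
    _ ≤ _ := by
        rw [one_mul]
        gcongr
        exact hle _ hroot

/-- As `|r - 1| < r + 1` and `|B*| ≤ |B|` on the disc, the term with `B` dominates. -/
theorem schurTransform_ne_zero {N : ℕ} (hN : 1 ≤ N) {r : ℝ} (hr : 0 < r) {B : ℝ[X]}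
    (hB : B.natDegree ≤ N) (h0 : ∀ z : ℂ, ‖z‖ ≤ 1 → aeval z B ≠ 0) {z : ℂ} (hz : ‖z‖ ≤ 1) :
    aeval z (schurTransform N r B) ≠ 0 := by
  intro h
  have h1 : aeval z B * (((r + 1) / 2 : ℝ) : ℂ) =
      -(((r - 1) / 2 : ℝ) : ℂ) * aeval z (reflect N B) := by
    simp only [schurTransform, map_add, map_mul, aeval_C, Complex.coe_algebraMap] at h
    linear_combination h
  have h2 := congrArg norm h1
  rw [norm_mul, norm_mul, norm_neg, Complex.norm_real, Complex.norm_real, Real.norm_eq_abs,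
    Real.norm_eq_abs, abs_of_pos (by linarith : 0 < (r + 1) / 2)] at h2
  have h3 := norm_reflect_le_of_no_zeros hN hB h0 hz
  have h4 : 0 < ‖aeval z B‖ := norm_pos_iff.2 (h0 z hz)
  have h5 : |(r - 1) / 2| < (r + 1) / 2 := abs_lt.2 ⟨by linarith, by linarith⟩
  nlinarith [abs_nonneg ((r - 1) / 2), norm_nonneg (aeval z (reflect N B))]

/-- From `|B_{k+1}| < |B_0|`, the sum and the difference of these two coefficients have the same
sign. -/
theorem Represents.ratio_pos {k : ℕ} {M : ℝ} {B : ℝ[X]} {w : ℕ → ℝ}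
    (h : Represents (k + 1) M B w) (hM : 0 < M) (h0 : ∀ z : ℂ, ‖z‖ ≤ 1 → aeval z B ≠ 0) :
    0 < ratio k w := by
  have hlt := norm_coeff_lt_of_no_zeros (by omega) h.natDegree_le h0
  rw [h.ratio_eq, mul_div_assoc]
  refine mul_pos hM ?_
  have h1 : 0 < (B.coeff 0 + B.coeff (k + 1)) * (B.coeff 0 - B.coeff (k + 1)) := by
    have := sq_lt_sq.2 hlt
    nlinarith
  rcases mul_pos_iff.1 h1 with h | h
  · exact div_pos h.1 h.2
  · exact div_pos_of_neg_of_neg h.1 h.2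

theorem exists_represents_vec {g : ℕ} {z : ℕ → ℝ} {M : ℝ} {B : ℝ[X]} (hM : 0 < M)
    (hz : Represents (2 * g) M B z) (h0 : ∀ x : ℂ, ‖x‖ ≤ 1 → aeval x B ≠ 0) (n : ℕ)
    (hn : n ≤ 2 * g) :
    ∃ M' : ℝ, ∃ B' : ℝ[X], 0 < M' ∧ Represents (2 * g - n) M' B' (vec g z n) ∧
      ∀ x : ℂ, ‖x‖ ≤ 1 → aeval x B' ≠ 0 := by
  induction n with
  | zero => exact ⟨M, B, hM, hz, h0⟩
  | succ n ih =>
    obtain ⟨M', B', hM', hR, hB'⟩ := ih (by omega)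
    rw [show 2 * g - n = 2 * g - (n + 1) + 1 by omega] at hR
    have hm := hR.ratio_pos hM' hB'
    exact ⟨_, _, hm, hR.step hm.ne',
      fun x hx => schurTransform_ne_zero (by omega) (div_pos hM' hm) hR.natDegree_le hB' hx⟩

theorem mValue_pos {g : ℕ} {z : ℕ → ℝ} {M : ℝ} {B : ℝ[X]} (hM : 0 < M)
    (hz : Represents (2 * g) M B z) (h0 : ∀ x : ℂ, ‖x‖ ≤ 1 → aeval x B ≠ 0) {n : ℕ}
    (h1 : 1 ≤ n) (hn : n ≤ 2 * g) : 0 < mValue g z n := by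
  obtain ⟨n, rfl⟩ := Nat.exists_eq_add_of_le' h1
  obtain ⟨M', B', hM', hR, hB'⟩ := exists_represents_vec hM hz h0 n (by omega)
  rw [show 2 * g - n = 2 * g - (n + 1) + 1 by omega] at hR
  exact hR.ratio_pos hM' hB'

/-- Induction on the degree bound, starting from the last, constant polynomial. The inequality `|B*|
≤ |B|` is carried along because absence of zeros alone does not pass back through the transform. -/
theorem no_zeros_of_mValue_pos {g : ℕ} {z : ℕ → ℝ}
    (hpos : ∀ n, 1 ≤ n → n ≤ 2 * g → 0 < mValue g z n) (k n : ℕ) (hkn : n + k = 2 * g)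
    {M : ℝ} {B : ℝ[X]} (hM : 0 < M) (hR : Represents k M B (vec g z n)) (hB : B.coeff 0 ≠ 0)
    {x : ℂ} (hx : ‖x‖ < 1) :
    aeval x B ≠ 0 ∧ ‖aeval x (reflect k B)‖ ≤ ‖aeval x B‖ := by
  induction k generalizing n M B with
  | zero =>
    obtain ⟨b, rfl⟩ : ∃ b, B = C b := ⟨_, eq_C_of_natDegree_le_zero hR.natDegree_le⟩
    have hb : b ≠ 0 := by simpa using hB
    simpa [aeval_C] using hb
  | succ k ih =>
    have hm : 0 < ratio k (vec g z n) := by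
      have := hpos (n + 1) (by omega) (by omega)
      rwa [mValue, Nat.add_sub_cancel, show 2 * g - (n + 1) = k by omega] at this
    have hrel := hR.ratio_relation hm.ne'
    have hR' := hR.step hm.ne'
    have hd : B.coeff 0 - B.coeff (k + 1) ≠ 0 := by
      intro hd
      have := hR.ratio_eq
      rw [hd, div_zero] at this
      exact hm.ne' this
    set r := M / ratio k (vec g z n) with hr
    have hr0 : 0 < r := div_pos hM hm
    set B' := schurTransform (k + 1) r B with hB'
    have hvec : vec g z (n + 1) = step k (ratio k (vec g z n)) (vec g z n) := by
      rw [vec, show 2 * g - (n + 1) = k by omega]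
    have hcoeff : B'.coeff 0 ≠ 0 := by
      rw [hB', coeff_schurTransform (Nat.zero_le _), Nat.sub_zero]
      -- By `hrel` the constant coefficient of `B'` equals `B_0 - B_{k+1}`, the nonzero denominator
      -- of `m` up to notation.
      convert hd using 1
      linear_combination (1 / 2) * hrel
    obtain ⟨h1, h2⟩ := ih (n + 1) (by omega) hm (by rwa [hvec]) hcoeff
    have h3 := aeval_schurTransform_norm_sq (k + 1) r B x
    -- The degree of `B'` has dropped, so its reciprocal with respect to `k + 1` has an extra factor
    -- `x`; `‖x‖ < 1` then makes the inequality strict.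
    rw [← hB', reflect_succ hR'.natDegree_le, map_mul, aeval_X, norm_mul] at h3
    have h4 : 0 < ‖aeval x B'‖ := norm_pos_iff.2 h1
    have h5 : ‖aeval x (reflect k B')‖ * ‖x‖ < ‖aeval x B'‖ := by
      nlinarith [norm_nonneg x, norm_nonneg (aeval x (reflect k B'))]
    have h6 : (‖aeval x (reflect k B')‖ * ‖x‖) ^ 2 < ‖aeval x B'‖ ^ 2 :=
      pow_lt_pow_left₀ h5 (by positivity) (by norm_num)
    have h7 : 0 < ‖aeval x B‖ ^ 2 - ‖aeval x (reflect (k + 1) B)‖ ^ 2 := by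
      by_contra! h
      nlinarith
    have h8 : ‖aeval x (reflect (k + 1) B)‖ < ‖aeval x B‖ :=
      (sq_lt_sq₀ (norm_nonneg _) (norm_nonneg _)).1 (by linarith)
    exact ⟨norm_pos_iff.1 ((norm_nonneg _).trans_lt h8), h8.le⟩

/-! ### The self-reciprocal polynomial -/

theorem coeff_selfReciprocalPoly (g : ℕ) (c : Fin (g + 1) → ℝ) {j : ℕ} (hj : j ≤ 2 * g) :
    (selfReciprocalPoly g c).coeff j = c ⟨min j (2 * g - j), by omega⟩ := by
  have key : ∀ i : Fin g, (C (c i.castSucc) * (X ^ (2 * g - (i : ℕ)) + X ^ (i : ℕ))).coeff j =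
      if (i : ℕ) = min j (2 * g - j) then c i.castSucc else 0 := by
    intro i
    have := i.2
    rw [coeff_C_mul, coeff_add, coeff_X_pow, coeff_X_pow]
    split_ifs <;> first | omega | simp
  rw [selfReciprocalPoly, coeff_add, finsetSum_coeff, Finset.sum_congr rfl fun i _ => key i,
    coeff_C_mul, coeff_X_pow]
  by_cases h : j = g
  · subst h
    rw [Finset.sum_eq_zero fun i _ => if_neg (by omega)]
    simp only [if_true, mul_one, zero_add]
    congr 1
    ext
    simp
    omega
  · rw [if_neg h, Finset.sum_eq_single (⟨min j (2 * g - j), by omega⟩ : Fin g)]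
    · simp
    · intro b _ hb
      exact if_neg fun h => hb (Fin.ext h)
    · simp

theorem natDegree_selfReciprocalPoly_le (g : ℕ) (c : Fin (g + 1) → ℝ) :
    (selfReciprocalPoly g c).natDegree ≤ 2 * g := by
  rw [natDegree_le_iff_coeff_eq_zero]
  intro j hj
  rw [selfReciprocalPoly, coeff_add, finsetSum_coeff, coeff_C_mul, coeff_X_pow,
    if_neg (by omega), mul_zero, add_zero]
  refine Finset.sum_eq_zero fun i _ => ?_
  have := i.2
  rw [coeff_C_mul, coeff_add, coeff_X_pow, coeff_X_pow, if_neg (by omega), if_neg (by omega)]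
  simp

theorem reflect_selfReciprocalPoly (g : ℕ) (c : Fin (g + 1) → ℝ) :
    reflect (2 * g) (selfReciprocalPoly g c) = selfReciprocalPoly g c := by
  ext j
  rw [coeff_reflect]
  rcases Nat.lt_or_ge (2 * g) j with h | h
  · rw [revAt_eq_self_of_lt h]
  · rw [revAt_le h, coeff_selfReciprocalPoly g c (Nat.sub_le _ _), coeff_selfReciprocalPoly g c h]
    congr 2
    omega

/-- The polynomial `s ^ g * P_g(x / s)`. -/
def scaledPoly (g : ℕ) (c : Fin (g + 1) → ℝ) (s : ℝ) : ℝ[X] :=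
  C (s ^ g) * (selfReciprocalPoly g c).comp (C s⁻¹ * X)

theorem aeval_scaledPoly (g : ℕ) (c : Fin (g + 1) → ℝ) (s : ℝ) (x : ℂ) :
    aeval x (scaledPoly g c s) = (s : ℂ) ^ g * aeval ((s : ℂ)⁻¹ * x) (selfReciprocalPoly g c) := by
  simp [scaledPoly, aeval_comp]

theorem coeff_scaledPoly (g : ℕ) (c : Fin (g + 1) → ℝ) (s : ℝ) (j : ℕ) :
    (scaledPoly g c s).coeff j = s ^ g * ((selfReciprocalPoly g c).coeff j * s⁻¹ ^ j) := by
  rw [scaledPoly, coeff_C_mul, comp_C_mul_X_coeff]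

theorem represents_initVec (g : ℕ) (c : Fin (g + 1) → ℝ) {q : ℝ} (hq : 0 < q) (ω : ℝ) :
    Represents (2 * g) 1 (scaledPoly g c (q ^ ω)) (initVec g c q ω) := by
  have key : ∀ j ≤ 2 * g, halfVec g c q ω (j + 1) = (scaledPoly g c (q ^ ω)).coeff j := by
    intro j hj
    rw [coeff_scaledPoly, coeff_selfReciprocalPoly g c hj, halfVec]
    simp only [Nat.add_sub_cancel]
    rw [sub_mul, Real.rpow_sub hq, mul_comm (g : ℝ), mul_comm (j : ℝ), Real.rpow_mul hq.le,
      Real.rpow_mul hq.le, Real.rpow_natCast, Real.rpow_natCast, inv_pow]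
    ring
  refine ⟨?_, ?_, ?_⟩
  · rw [natDegree_le_iff_coeff_eq_zero]
    intro j hj
    rw [coeff_scaledPoly, coeff_eq_zero_of_natDegree_lt
      ((natDegree_selfReciprocalPoly_le g c).trans_lt hj), zero_mul, mul_zero]
  · intro j hj
    rw [initVec, if_pos (by omega), key j hj, one_mul]
  · intro j hj
    rw [initVec, if_neg (by omega), show 2 * g + 1 + j + 1 - (2 * g + 1) = j + 1 by omega, key j hj]

theorem one_le_norm_of_mNumber_pos {g : ℕ} {q : ℝ} (hq : 1 < q) {c : Fin (g + 1) → ℝ}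
    (hc : c 0 ≠ 0) (hpos : ∀ n, 1 ≤ n → n ≤ 2 * g → ∀ ω : ℝ, 0 < ω → 0 < mNumber g c q ω n)
    {z : ℂ} (hz : aeval z (selfReciprocalPoly g c) = 0) : 1 ≤ ‖z‖ := by
  by_contra! hlt
  have hq0 : 0 < q := by linarith
  -- Take `ω = log_q t`, so that `q^ω = t`. The zero `z` of `P_g` becomes the zero `t z` of the
  -- scaled polynomial, still inside the open disc.
  obtain ⟨t, ht1, ht2⟩ : ∃ t : ℝ, 1 < t ∧ t * ‖z‖ < 1 := by
    rcases (norm_nonneg z).eq_or_lt with h | h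
    · exact ⟨2, by norm_num, by rw [← h]; norm_num⟩
    · obtain ⟨t, h1, h2⟩ := exists_between ((one_lt_div h).2 hlt)
      exact ⟨t, h1, (lt_div_iff₀ h).1 h2⟩
  have ht0 : 0 < t := by linarith
  have htq : q ^ Real.logb q t = t := Real.rpow_logb hq0 hq.ne' ht0
  have hR := represents_initVec g c hq0 (Real.logb q t)
  rw [htq] at hR
  have h := no_zeros_of_mValue_pos (fun n h1 h2 => hpos n h1 h2 _ (Real.logb_pos hq ht1))
    (2 * g) 0 (by omega) one_pos hR
    (by
      rw [coeff_scaledPoly, coeff_selfReciprocalPoly g c (Nat.zero_le _)]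
      have : c ⟨min 0 (2 * g - 0), by omega⟩ = c 0 := by congr 1
      rw [this]
      positivity)
    (x := (t : ℂ) * z) (by rwa [norm_mul, Complex.norm_real, Real.norm_of_nonneg ht0.le])
  refine h.1 ?_
  rw [aeval_scaledPoly, inv_mul_cancel_left₀ (by exact_mod_cast ht0.ne'), hz, mul_zero]

end

end SelfReciprocal

theorem theorem3 (g : ℕ) (hg : 1 ≤ g) (q : ℝ) (hq : 1 < q)
    (c : Fin (g + 1) → ℝ) (hc : c 0 ≠ 0) :
    (∀ z : ℂ, Polynomial.aeval z (SelfReciprocal.selfReciprocalPoly g c) = 0 → ‖z‖ = 1) ↔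
      ∀ n : ℕ, 1 ≤ n → n ≤ 2 * g → ∀ ω : ℝ, 0 < ω →
        0 < SelfReciprocal.mNumber g c q ω n ∧ 0 < (SelfReciprocal.mNumber g c q ω n)⁻¹ := by
  open SelfReciprocal in
  have hq0 : 0 < q := by linarith
  constructor
  · intro h n h1 h2 ω hω
    have hs : 1 < q ^ ω := Real.one_lt_rpow hq hω
    have hs0 : 0 < q ^ ω := by linarith
    have hpos : 0 < mNumber g c q ω n := by
      refine mValue_pos one_pos (represents_initVec g c hq0 ω) (fun x hx h0 => ?_) h1 h2
      rw [aeval_scaledPoly] at h0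
      have hne : ((q ^ ω : ℝ) : ℂ) ≠ 0 := by exact_mod_cast hs0.ne'
      -- A zero `x` of the scaled polynomial satisfies `‖x / s‖ = 1` with `s = q ^ ω`, so `‖x‖ = s >
      -- 1`.
      have h3 := h _ ((mul_eq_zero.1 h0).resolve_left (pow_ne_zero _ hne))
      rw [norm_mul, norm_inv, Complex.norm_real, Real.norm_of_nonneg hs0.le,
        inv_mul_eq_one₀ hs0.ne'] at h3
      linarith
    exact ⟨hpos, inv_pos.2 hpos⟩
  · intro h z hz
    have hle : ∀ z : ℂ, aeval z (selfReciprocalPoly g c) = 0 → 1 ≤ ‖z‖ := fun z hz =>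
      one_le_norm_of_mNumber_pos hq hc (fun n h1 h2 ω hω => (h n h1 h2 ω hω).1) hz
    have h1 := hle z hz
    have hz0 : z ≠ 0 := norm_pos_iff.1 (by linarith)
    -- By self-reciprocity `z⁻¹` is a zero as well, so the lower bound applied to it gives `‖z‖ ≤
    -- 1`.
    have h2 := aeval_reflect (natDegree_selfReciprocalPoly_le g c) hz0
    rw [reflect_selfReciprocalPoly, hz] at h2
    have h3 := hle z⁻¹ ((mul_eq_zero.1 h2.symm).resolve_left (pow_ne_zero _ hz0))
    rw [norm_inv] at h3
    exact le_antisymm ((one_le_inv₀ (by linarith)).1 h3) h1
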